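/- Let $E$ be a real or complex Banach space that contains no copy of $\ell_1$, that is, no linear subspace of $E$ is isomorphic (linearly homeomorphic) to the space $\ell_1$ of absolutely summable scalar sequences. Let $F$ be a norm-closed infinite-dimensional linear subspace of the topological dual $E^*$, and let $\ell_\infty(F)$ be the Banach space of bounded $F$-valued sequences with the supremum norm. Put $$\mathcal{C} = \{(x_j^*)_{j=1}^\infty \in \ell_\infty(F) : x_j^* \to 0 \text{ in the weak}^* \text{ topology of } E^* \text{ and } \|x_j^*\| \not\to 0\}.$$ Then $\mathcal{C}$ is almost pointwise spaceable in $\ell_\infty(F)$: the set $\mathcal{C}$ is nonempty, and for every sequence $\mathbf{x}^* \in \mathcal{C}$ there is a closed infinite-dimensional linear subspace $W$ of $\ell_\infty(F)$ such that $W \subseteq \mathcal{C} \cup \{0\}$ and $W$ contains a subsequence of $\mathbf{x}^*$. -/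

import Mathlib

open Filter Topology
open scoped ENNReal

/-- `ℓ_∞(G)`: bounded `G`-valued sequences, with the supremum norm. -/
abbrev EllInfty (G : Type*) [NormedAddCommGroup G] : Type _ :=
  lp (fun _ : ℕ => G) ∞

/-- `ℓ₁` over the scalar field `𝕜`. -/
abbrev EllOne (𝕜 : Type*) [RCLike 𝕜] : Type _ :=
  lp (fun _ : ℕ => 𝕜) 1

/-- `E` contains a copy of `ℓ₁`: some linear subspace of `E` is linearly homeomorphic to `ℓ₁`. -/
def ContainsCopyEllOne (𝕜 E : Type*) [RCLike 𝕜] [NormedAddCommGroup E] [NormedSpace 𝕜 E] : Prop :=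
  ∃ S : Submodule 𝕜 E, Nonempty (EllOne 𝕜 ≃L[𝕜] S)

/-- `y` is a subsequence of `x`. -/
def IsSubseq {G : Type*} (y x : ℕ → G) : Prop :=
  ∃ φ : ℕ → ℕ, StrictMono φ ∧ y = x ∘ φ

/-- A nonvoid set `A ⊆ ℓ_∞(G)` is almost pointwise spaceable in `ℓ_∞(G)` if for every `x ∈ A` some
closed infinite dimensional subspace `W` of `ℓ_∞(G)` is contained in `A ∪ {0}` and contains a
subsequence of `x`. -/
def AlmostPointwiseSpaceable (𝕜 : Type*) {G : Type*} [RCLike 𝕜] [NormedAddCommGroup G]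
    [NormedSpace 𝕜 G] (A : Set (EllInfty G)) : Prop :=
  A.Nonempty ∧
    ∀ x ∈ A, ∃ W : Submodule 𝕜 (EllInfty G),
      IsClosed (W : Set (EllInfty G)) ∧ ¬ FiniteDimensional 𝕜 W ∧
      (W : Set (EllInfty G)) ⊆ A ∪ {0} ∧ ∃ y ∈ W, IsSubseq (y : ℕ → G) (x : ℕ → G)

/-- The bounded sequences in `F ⊆ E*` that are weak*-null in `E*` but not norm null. -/
def weakStarNullNotNormNull {𝕜 E : Type*} [RCLike 𝕜] [NormedAddCommGroup E] [NormedSpace 𝕜 E]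
    (F : Submodule 𝕜 (StrongDual 𝕜 E)) : Set (EllInfty F) :=
  {x | Tendsto (fun j => StrongDual.toWeakDual (x j : StrongDual 𝕜 E)) atTop
        (𝓝 (0 : WeakDual 𝕜 E)) ∧
      ¬ Tendsto (fun j => x j) atTop (𝓝 (0 : F))}

/-! Spaceability is the soft half. A weak*-null sequence that is not norm null has a subsequence `y`
with norms at least some `c > 0`. Multiplying its terms by the entries of `a ∈ ℓ_∞`, each entry used
infinitely often, embeds `ℓ_∞` isomorphically into `ℓ_∞(F)`, and the image is the required subspace.

Nonemptiness is a Josefson–Nissenzweig statement inside `F`. Riesz's lemma gives a bounded separated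
sequence in `F`. If a subsequence converges weakly, differences of its successive terms will do.
Otherwise some ultrafilter limit in the bidual of `E*` lies off `E*`, and James functionals keep far
convex combinations away from earlier ones (`exists_weakly_convergent_or_isJamesSeq`,
`IsJamesSeq.exists_le_norm_sub`). Since `E` has no copy of `ℓ₁`, suitable convex tails are
weak*-Cauchy (`exists_weakStar_cauchy_isConvexTail`); their differences can then be chosen
weak*-null and bounded below in norm.

For the Cauchy property, choose convex tails whose oscillation `δ` over the unit ball cannot be
lowered by further convex tails. If `δ > 0`, averaging `2 ^ k` subsequences does not lower it, so
one point of the ball splits all of them at once by nearly `δ`. Iteration grows a dyadic tree, whose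
points span a copy of `ℓ₁`. Near-maximality of the splits also bounds the imaginary parts, which
settles complex scalars. -/

/-! ### A copy of `ℓ_∞` through a subsequence. -/

section Spaceability

variable {𝕜 G : Type*} [RCLike 𝕜] [NormedAddCommGroup G] [NormedSpace 𝕜 G]

/-- The operator `ℓ_∞ → ℓ_∞(G)` that multiplies the `n`-th term of `y` by the scalar
`a (n.unpair.1)`, so that every entry of `a` is used infinitely often. -/
noncomputable def spreadMul (𝕜 : Type*) [RCLike 𝕜] [NormedSpace 𝕜 G] (y : EllInfty G) :
    EllInfty 𝕜 →L[𝕜] EllInfty G :=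
  LinearMap.mkContinuous
    { toFun := fun a => ⟨fun n => a n.unpair.1 • y n, by
        refine memℓp_infty ⟨‖a‖ * ‖y‖, ?_⟩
        rintro _ ⟨n, rfl⟩
        simp only [norm_smul]
        gcongr
        · exact lp.norm_apply_le_norm (by simp) a _
        · exact lp.norm_apply_le_norm (by simp) y n⟩
      map_add' := fun a b => by
        apply lp.ext; funext n
        exact add_smul (a n.unpair.1) (b n.unpair.1) (y n)
      map_smul' := fun c a => by
        apply lp.ext; funext n
        exact mul_smul c (a n.unpair.1) (y n) } ‖y‖ (fun a => by
    refine lp.norm_le_of_forall_le (by positivity) fun n => ?_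
    change ‖a n.unpair.1 • y n‖ ≤ _
    rw [norm_smul, mul_comm]
    gcongr
    · exact lp.norm_apply_le_norm (by simp) y n
    · exact lp.norm_apply_le_norm (by simp) a _)

theorem spreadMul_apply (y : EllInfty G) (a : EllInfty 𝕜) (n : ℕ) :
    spreadMul 𝕜 y a n = a n.unpair.1 • y n := rfl

/-- Every entry `a i` is visible at the index `Nat.pair i 0`, where it multiplies a vector of norm
at least `c`. -/
theorem le_norm_spreadMul {y : EllInfty G} {c : ℝ} (hc : 0 ≤ c) (hy : ∀ n, c ≤ ‖y n‖)
    (a : EllInfty 𝕜) : c * ‖a‖ ≤ ‖spreadMul 𝕜 y a‖ := by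
  rcases hc.eq_or_lt with rfl | hc
  · simp
  rw [mul_comm, ← le_div_iff₀ hc]
  refine lp.norm_le_of_forall_le (by positivity) fun i => ?_
  rw [le_div_iff₀ hc]
  refine le_trans ?_ (lp.norm_apply_le_norm (by simp) (spreadMul 𝕜 y a) (Nat.pair i 0))
  rw [spreadMul_apply, norm_smul, Nat.unpair_pair]
  gcongr
  exact hy _

theorem antilipschitz_spreadMul {y : EllInfty G} {c : ℝ} (hc : 0 < c) (hy : ∀ n, c ≤ ‖y n‖) :
    AntilipschitzWith (Real.toNNReal c⁻¹) (spreadMul 𝕜 y) := by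
  refine ContinuousLinearMap.antilipschitz_of_bound _ fun a => ?_
  rw [Real.coe_toNNReal _ (by positivity), inv_mul_eq_div, le_div_iff₀ hc, mul_comm]
  exact le_norm_spreadMul hc.le hy a

theorem not_finiteDimensional_ellInfty : ¬ FiniteDimensional 𝕜 (EllInfty 𝕜) := by
  intro h
  have hli : LinearIndependent 𝕜 fun i : ℕ => (lp.single ∞ i (1 : 𝕜) : EllInfty 𝕜) := by
    rw [linearIndependent_iff']
    intro s g hg i hi
    have := congrArg (fun f : EllInfty 𝕜 => f i) hg
    rw [lp.coeFn_sum, Finset.sum_apply] at this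
    simpa [lp.single_apply, Pi.single_apply, hi] using this
  have := hli.finite
  exact not_finite ℕ

variable {E : Type*} [NormedAddCommGroup E] [NormedSpace 𝕜 E]

theorem mem_weakStarNullNotNormNull_iff {F : Submodule 𝕜 (StrongDual 𝕜 E)} {x : EllInfty F} :
    x ∈ weakStarNullNotNormNull F ↔
      (∀ e, Tendsto (fun j => (x j : StrongDual 𝕜 E) e) atTop (𝓝 0)) ∧
        ¬ Tendsto (fun j => ‖x j‖) atTop (𝓝 0) := by
  refine and_congr ?_ (not_congr ?_)
  · rw [tendsto_iff_forall_eval_tendsto_topDualPairing]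
    rfl
  · exact tendsto_zero_iff_norm_tendsto_zero (E := F)

theorem exists_closed_subspace_subset_weakStarNullNotNormNull
    {F : Submodule 𝕜 (StrongDual 𝕜 E)} {x : EllInfty F} (hx : x ∈ weakStarNullNotNormNull F) :
    ∃ W : Submodule 𝕜 (EllInfty F),
      IsClosed (W : Set (EllInfty F)) ∧ ¬ FiniteDimensional 𝕜 W ∧
      (W : Set (EllInfty F)) ⊆ weakStarNullNotNormNull F ∪ {0} ∧
      ∃ y ∈ W, IsSubseq (y : ℕ → F) (x : ℕ → F) := by
  obtain ⟨hx0, hxn⟩ := mem_weakStarNullNotNormNull_iff.1 hx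
  obtain ⟨c, hc, hfreq⟩ : ∃ c > 0, ∃ᶠ n in atTop, c ≤ ‖x n‖ := by
    rw [Metric.tendsto_atTop'] at hxn
    push Not at hxn
    obtain ⟨c, hc, h⟩ := hxn
    refine ⟨c, hc, frequently_atTop.2 fun N => ?_⟩
    obtain ⟨n, hn, h⟩ := h N
    exact ⟨n, hn.le, h.trans_eq (by rw [Real.dist_0_eq_abs]; exact abs_norm (x n))⟩
  obtain ⟨φ, hφ, hφc⟩ := extraction_of_frequently_atTop hfreq
  let y : EllInfty F := ⟨fun n => x (φ n), memℓp_infty ⟨‖x‖, by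
    rintro _ ⟨n, rfl⟩
    exact lp.norm_apply_le_norm (by simp) x _⟩⟩
  have hyc : ∀ n, c ≤ ‖y n‖ := hφc
  have hanti := antilipschitz_spreadMul (𝕜 := 𝕜) hc hyc
  refine ⟨LinearMap.range (spreadMul 𝕜 y).toLinearMap, ?_, ?_, ?_, ?_⟩
  · have := hanti.isClosed_range (spreadMul 𝕜 y).uniformContinuous
    rw [LinearMap.coe_range]
    exact this
  · intro hfin
    refine not_finiteDimensional_ellInfty (𝕜 := 𝕜) ?_
    exact Module.Finite.equiv
      (LinearEquiv.ofInjective (spreadMul 𝕜 y).toLinearMap hanti.injective).symm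
  · rintro _ ⟨a, rfl⟩
    by_cases ha : a = 0
    · right; simp [ha]
    left
    refine mem_weakStarNullNotNormNull_iff.2 ⟨fun e => ?_, fun h0 => ?_⟩
    · have h1 := (hx0 e).comp hφ.tendsto_atTop
      refine squeeze_zero_norm (a := fun n => ‖a‖ * ‖(x (φ n) : StrongDual 𝕜 E) e‖)
        (fun n => ?_) ?_
      · change ‖a n.unpair.1 * (x (φ n) : StrongDual 𝕜 E) e‖ ≤ _
        rw [norm_mul]
        gcongr
        exact lp.norm_apply_le_norm (by simp) a _
      · simpa using h1.norm.const_mul ‖a‖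
    -- Along the indices `Nat.pair i k`, `k → ∞`, the norms stay above `‖a i‖ * c > 0`.
    · obtain ⟨i, hi⟩ : ∃ i, a i ≠ 0 := by
        by_contra! h
        exact ha (lp.ext (funext h))
      have ht : Tendsto (fun k => Nat.pair i k) atTop atTop :=
        tendsto_atTop_mono (fun k => Nat.right_le_pair i k) tendsto_id
      have h1 := h0.comp ht
      have h2 : ∀ k, ‖a i‖ * c ≤ ‖spreadMul 𝕜 y a (Nat.pair i k)‖ := fun k => by
        rw [spreadMul_apply, norm_smul, Nat.unpair_pair]
        gcongr
        exact hyc _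
      have h3 := ge_of_tendsto' h1 h2
      have : 0 < ‖a i‖ * c := by positivity
      linarith
  · refine ⟨y, ⟨1, ?_⟩, φ, hφ, rfl⟩
    apply lp.ext; funext n
    change (1 : 𝕜) • y n = y n
    simp

end Spaceability

/-! ### Recognising copies of `ℓ₁`. -/

section EllOneEmbedding

variable {𝕜 E : Type*} [RCLike 𝕜] [NormedAddCommGroup E] [NormedSpace 𝕜 E] [CompleteSpace E]

theorem containsCopyEllOne_of_lower_bound {e : ℕ → E} (he : ∀ i, ‖e i‖ ≤ 1) {κ : ℝ} (hκ : 0 < κ)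
    (h : ∀ (k : ℕ) (c : ℕ → 𝕜),
      κ * ∑ i ∈ Finset.range k, ‖c i‖ ≤ ‖∑ i ∈ Finset.range k, c i • e i‖) :
    ContainsCopyEllOne 𝕜 E := by
  have hnorm : ∀ c : EllOne 𝕜, HasSum (fun i => ‖c i‖) ‖c‖ := fun c => by
    simpa using lp.hasSum_norm (p := 1) (by simp) c
  have hle : ∀ (c : EllOne 𝕜) i, ‖c i • e i‖ ≤ ‖c i‖ := fun c i => by
    rw [norm_smul]
    exact mul_le_of_le_one_right (norm_nonneg _) (he i)
  have hsum : ∀ c : EllOne 𝕜, Summable fun i => c i • e i := fun c =>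
    Summable.of_norm_bounded (hnorm c).summable (hle c)
  let T : EllOne 𝕜 →ₗ[𝕜] E :=
    { toFun := fun c => ∑' i, c i • e i
      map_add' := fun a b => by
        rw [← (hsum a).tsum_add (hsum b)]
        exact tsum_congr fun i => add_smul (a i) (b i) (e i)
      map_smul' := fun r a => by
        rw [RingHom.id_apply, ← (hsum a).tsum_const_smul r]
        exact tsum_congr fun i => mul_smul r (a i) (e i) }
  have hT : ∀ c, HasSum (fun i => c i • e i) (T c) := fun c => (hsum c).hasSum
  have hub : ∀ c, ‖T c‖ ≤ 1 * ‖c‖ := fun c => by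
    rw [one_mul]
    exact (hT c).norm_le_of_bounded (hnorm c) (hle c)
  have hlb : ∀ c, κ * ‖c‖ ≤ ‖T c‖ := fun c =>
    le_of_tendsto_of_tendsto' ((hnorm c).tendsto_sum_nat.const_mul κ)
      (hT c).tendsto_sum_nat.norm fun k => h k c
  have hinj : Function.Injective T := by
    rw [← LinearMap.ker_eq_bot, LinearMap.ker_eq_bot']
    intro c hc
    have h1 := hlb c
    rw [hc, norm_zero] at h1
    exact norm_le_zero_iff.1 (nonpos_of_mul_nonpos_right h1 hκ)
  refine ⟨LinearMap.range T, ⟨(LinearEquiv.ofInjective T hinj).toContinuousLinearEquivOfBounds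
    1 κ⁻¹ hub fun z => ?_⟩⟩
  obtain ⟨c, rfl⟩ := (LinearEquiv.ofInjective T hinj).surjective z
  rw [LinearEquiv.symm_apply_apply, inv_mul_eq_div, le_div_iff₀ hκ, mul_comm]
  exact hlb c

end EllOneEmbedding

/-! ### Weak convergence versus James separation. -/

section WeakDichotomy

variable {𝕜 X : Type*} [RCLike 𝕜] [NormedAddCommGroup X] [NormedSpace 𝕜 X]

/-- Banach–Alaoglu in the bidual, along an ultrafilter. -/
theorem exists_bidual_limit (𝕜 : Type*) [RCLike 𝕜] [NormedSpace 𝕜 X] {x : ℕ → X} {M : ℝ}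
    (hx : ∀ n, ‖x n‖ ≤ M) (U : Ultrafilter ℕ) :
    ∃ z : StrongDual 𝕜 (StrongDual 𝕜 X), ∀ φ : StrongDual 𝕜 X,
      Tendsto (fun n => φ (x n)) U (𝓝 (z φ)) := by
  let J := NormedSpace.inclusionInDoubleDual 𝕜 X
  have hK := WeakDual.isCompact_closedBall (𝕜 := 𝕜) (E := StrongDual 𝕜 X) 0 M
  let g : ℕ → WeakDual 𝕜 (StrongDual 𝕜 X) := fun n => StrongDual.toWeakDual (J (x n))
  have hg : ∀ n, g n ∈ WeakDual.toStrongDual ⁻¹'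
      Metric.closedBall (0 : StrongDual 𝕜 (StrongDual 𝕜 X)) M := fun n => by
    change J (x n) ∈ Metric.closedBall (0 : StrongDual 𝕜 (StrongDual 𝕜 X)) M
    refine (mem_closedBall_zero_iff (E := StrongDual 𝕜 (StrongDual 𝕜 X))).2 ?_
    exact (NormedSpace.double_dual_bound 𝕜 X (x n)).trans (hx n)
  obtain ⟨z, -, hz⟩ := hK.ultrafilter_le_nhds (U.map g)
    (le_principal_iff.2 (by exact Filter.mem_map.2 (univ_mem' hg)))
  refine ⟨WeakDual.toStrongDual z, fun φ => ?_⟩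
  have h1 : Tendsto g U (𝓝 z) := hz
  rw [tendsto_iff_forall_eval_tendsto_topDualPairing] at h1
  exact h1 φ

/-- A functional at distance `≥ θ` from the span of finitely many functionals has norm `≥ θ` on
their common kernel. -/
theorem exists_mem_ker_half_lt_re {θ : ℝ} (hθ : 0 < θ) {k : ℕ} {f : Fin k → StrongDual 𝕜 X}
    {z : StrongDual 𝕜 X} (hz : ∀ c : Fin k → 𝕜, θ ≤ ‖z - ∑ i, c i • f i‖) :
    ∃ v : X, ‖v‖ ≤ 1 ∧ (∀ i, f i v = 0) ∧ θ / 2 < RCLike.re (z v) := by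
  let p : Submodule 𝕜 X := ⨅ i, LinearMap.ker (f i).toLinearMap
  have hp : ∀ v, v ∈ p ↔ ∀ i, f i v = 0 := fun v => by
    simp [p, Submodule.mem_iInf]
  by_contra! hcon
  have hbound : ∀ v : p, ‖z v‖ ≤ θ / 2 * ‖v‖ := by
    intro v
    rcases eq_or_ne (z v) 0 with h0 | h0
    · rw [h0, norm_zero]; positivity
    have hv0 : ‖(v : X)‖ ≠ 0 := by
      intro h
      rw [norm_eq_zero] at h
      exact h0 (by rw [h, map_zero])
    obtain ⟨u, hu, huz⟩ := RCLike.exists_norm_eq_mul_self (z v)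
    have h1 := hcon (((‖(v : X)‖⁻¹ : ℝ) * u : 𝕜) • (v : X))
      (by rw [norm_smul, norm_mul, hu, RCLike.norm_ofReal, abs_of_nonneg (by positivity), mul_one,
        inv_mul_cancel₀ hv0])
      (fun i => by rw [map_smul, (hp v).1 v.2 i, smul_zero])
    rw [map_smul, smul_eq_mul, mul_assoc, ← huz, RCLike.re_ofReal_mul, RCLike.ofReal_re,
      inv_mul_eq_div, div_le_iff₀ (by positivity)] at h1
    exact h1
  -- A Hahn–Banach extension `g` of `z` restricted to the common kernel has norm at most `θ / 2`,
  -- while `z - g` vanishes there and so is a combination of the `f i`. Thus `g` is too close to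
  -- zero for `hz`.
  obtain ⟨g, hgf, hgn⟩ := exists_extension_norm_eq p (z.comp p.subtypeL)
  have hfn : ‖z.comp p.subtypeL‖ ≤ θ / 2 :=
    ContinuousLinearMap.opNorm_le_bound _ (by positivity) hbound
  have hspan : (z - g).toLinearMap ∈ Submodule.span 𝕜 (Set.range fun i => (f i).toLinearMap) := by
    refine mem_span_of_iInf_ker_le_ker fun v hv => ?_
    have := hgf ⟨v, hv⟩
    simp only [LinearMap.mem_ker, ContinuousLinearMap.coe_coe, sub_apply]
    rw [this]
    exact sub_self _
  obtain ⟨c, hc⟩ := (Submodule.mem_span_range_iff_exists_fun 𝕜).1 hspan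
  have hzg : z - ∑ i, c i • f i = g := by
    have h2 : z - g = ∑ i, c i • f i := by
      ext v
      have := LinearMap.congr_fun hc v
      simp only [ContinuousLinearMap.coe_coe] at this
      rw [← this]
      simp
    rw [← h2]; abel
  have h3 := hz c
  rw [hzg, hgn] at h3
  linarith

/-- A bidual element at distance `≥ θ` from `X` has norm `≥ θ` on the annihilator of each finite
subset of `X`. -/
theorem exists_annihilating_functional {z : StrongDual 𝕜 (StrongDual 𝕜 X)} {θ : ℝ} (hθ : 0 < θ)
    (hz : ∀ v : X, θ ≤ ‖z - NormedSpace.inclusionInDoubleDual 𝕜 X v‖) {k : ℕ} (v : Fin k → X) :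
    ∃ φ : StrongDual 𝕜 X, ‖φ‖ ≤ 1 ∧ (∀ i, φ (v i) = 0) ∧ θ / 2 < RCLike.re (z φ) :=
  exists_mem_ker_half_lt_re hθ (f := fun i => NormedSpace.inclusionInDoubleDual 𝕜 X (v i))
    fun c => by simpa only [map_sum, map_smul] using hz (∑ i, c i • v i)

/-- The terms of `x` are separated by functionals in the manner of James: `φ j` vanishes on the
terms before `j` and has real part at least `θ` on the terms from `j` on. -/
def IsJamesSeq (θ : ℝ) (x : ℕ → X) (φ : ℕ → StrongDual 𝕜 X) : Prop :=
  (∀ j, ‖φ j‖ ≤ 1) ∧ (∀ j k, k < j → φ j (x k) = 0) ∧ ∀ j k, j ≤ k → θ ≤ RCLike.re (φ j (x k))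

/-- Two choices alternate: a functional killing the terms chosen so far on which `z` is large, then
a term on which this and all earlier functionals are large. The latter is finitely many conditions,
each holding along `U`. The chosen indices need not increase. -/
theorem exists_isJamesSeq_of_bidual_limit {x : ℕ → X} {U : Ultrafilter ℕ}
    {z : StrongDual 𝕜 (StrongDual 𝕜 X)}
    (hlim : ∀ φ : StrongDual 𝕜 X, Tendsto (fun n => φ (x n)) U (𝓝 (z φ))) {θ : ℝ} (hθ : 0 < θ)
    (hz : ∀ v : X, θ ≤ ‖z - NormedSpace.inclusionInDoubleDual 𝕜 X v‖) :
    ∃ (ψ : ℕ → ℕ) (φ : ℕ → StrongDual 𝕜 X), IsJamesSeq (θ / 2) (x ∘ ψ) φ := by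
  choose Φ hΦ1 hΦ2 hΦ3 using fun (l : List ℕ) =>
    exists_annihilating_functional hθ hz (fun i : Fin l.length => x (l.get i))
  have hev : ∀ l, ∀ᶠ n in (U : Filter ℕ), θ / 2 < RCLike.re (Φ l (x n)) := fun l =>
    ((RCLike.continuous_re.tendsto _).comp (hlim (Φ l))).eventually_const_lt (hΦ3 l)
  have hex : ∀ l : List ℕ, ∃ n, ∀ m ≤ l.length, θ / 2 < RCLike.re (Φ (l.drop m) (x n)) := fun l =>
    ((eventually_all_finite (Set.finite_Iic l.length)).2 fun m _ => hev _).exists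
  choose N hN using hex
  -- The indices chosen so far, newest first, so that the earlier stages are exactly the suffixes
  -- `drop m`.
  let L : ℕ → List ℕ := fun k => Nat.rec [] (fun _ l => N l :: l) k
  have hL : ∀ k, L (k + 1) = N (L k) :: L k := fun k => rfl
  have hlen : ∀ k, (L k).length = k := fun k => by
    induction k with
    | zero => rfl
    | succ k ih => rw [hL, List.length_cons, ih]
  have hdrop : ∀ j k, (L (k + j)).drop j = L k := fun j => by
    induction j with
    | zero => intro k; simp
    | succ j ih => intro k; rw [← add_assoc, hL, List.drop_succ_cons, ih]
  have hmem : ∀ j k, k < j → N (L k) ∈ L j := fun j => by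
    induction j with
    | zero => intro k hk; omega
    | succ j ih =>
      intro k hk
      rw [hL]
      rcases Nat.lt_succ_iff_lt_or_eq.1 hk with h | rfl
      · exact List.mem_cons_of_mem _ (ih k h)
      · exact List.mem_cons_self
  refine ⟨fun k => N (L k), fun j => Φ (L j), fun j => hΦ1 _, fun j k hkj => ?_, fun j k hjk => ?_⟩
  · obtain ⟨i, hi⟩ := List.get_of_mem (hmem j k hkj)
    have := hΦ2 (L j) i
    rwa [hi] at this
  · obtain ⟨d, rfl⟩ := Nat.exists_eq_add_of_le hjk
    have := hN (L (j + d)) d (by rw [hlen]; omega)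
    rw [hdrop] at this
    exact this.le

/-- The closed span of a sequence is separated by countably many functionals. -/
theorem exists_countable_separating_functionals (𝕜 : Type*) [RCLike 𝕜] [NormedSpace 𝕜 X]
    (x : ℕ → X) :
    ∃ φ : ℕ → StrongDual 𝕜 X, ∀ v ∈ (Submodule.span 𝕜 (Set.range x)).topologicalClosure,
      (∀ k, φ k v = 0) → v = 0 := by
  let G := (Submodule.span 𝕜 (Set.range x)).topologicalClosure
  have hsep : TopologicalSpace.IsSeparable (G : Set X) := by
    rw [Submodule.topologicalClosure_coe]
    exact ((Set.countable_range x).isSeparable.span).closure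
  obtain ⟨D, hDc, hD⟩ := hsep
  rcases D.eq_empty_or_nonempty with rfl | hne
  · exact ⟨0, fun v hv _ => by simpa using hD hv⟩
  obtain ⟨d, rfl⟩ := hDc.exists_eq_range hne
  choose φ hφ1 hφ2 using fun k => exists_dual_vector'' 𝕜 (d k)
  refine ⟨φ, fun v hv h0 => ?_⟩
  by_contra hv0
  have hpos : 0 < ‖v‖ / 2 := by positivity
  obtain ⟨_, ⟨k, rfl⟩, hk⟩ := Metric.mem_closure_iff.1 (hD hv) _ hpos
  rw [dist_eq_norm] at hk
  -- `φ k` norms `d k` and kills `v`, although `d k` is close to `v`.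
  have h1 : ‖d k‖ ≤ ‖v - d k‖ := by
    calc ‖d k‖ = ‖φ k (v - d k)‖ := by
          rw [map_sub, h0, hφ2, zero_sub, norm_neg, RCLike.norm_ofReal, abs_norm]
      _ ≤ ‖v - d k‖ := (φ k).le_of_opNorm_le_of_le (hφ1 k) le_rfl |>.trans_eq (one_mul _)
  have h2 : ‖v‖ ≤ ‖v - d k‖ + ‖d k‖ := by simpa using norm_add_le (v - d k) (d k)
  linarith

/-- A point that agrees with limits of functionals along the sequence lies in its closed span. -/
theorem mem_closure_span_of_weak_limit {x : ℕ → X} {U : Filter ℕ} [U.NeBot] {v : X}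
    (hv : ∀ φ : StrongDual 𝕜 X, Tendsto (fun n => φ (x n)) U (𝓝 (φ v))) :
    v ∈ (Submodule.span 𝕜 (Set.range x)).topologicalClosure := by
  set G := (Submodule.span 𝕜 (Set.range x)).topologicalClosure
  have : IsClosed (G : Set X) := Submodule.isClosed_topologicalClosure _
  have hxG : ∀ n, x n ∈ G := fun n =>
    Submodule.le_topologicalClosure _ (Submodule.subset_span ⟨n, rfl⟩)
  obtain ⟨g, -, hg⟩ := exists_dual_vector'' 𝕜 (G.mkQ v)
  have h1 := hv (g.comp G.mkQL)
  have h2 : ∀ n, (g.comp G.mkQL) (x n) = 0 := fun n => by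
    have : G.mkQ (x n) = 0 := (Submodule.Quotient.mk_eq_zero G).2 (hxG n)
    change g (G.mkQ (x n)) = 0
    rw [this, map_zero]
  simp only [h2] at h1
  have h3 : g (G.mkQ v) = 0 := (tendsto_nhds_unique tendsto_const_nhds h1).symm
  rw [hg, RCLike.ofReal_eq_zero, norm_eq_zero] at h3
  exact (Submodule.Quotient.mk_eq_zero G).1 h3

/-- Eberlein–Šmulian: if all ultrafilter limits in the bidual lie in `X`, some subsequence
converges weakly. -/
theorem exists_weakly_convergent_subseq {x : ℕ → X} {M : ℝ} (hx : ∀ n, ‖x n‖ ≤ M)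
    (h : ∀ U : Ultrafilter ℕ, (U : Filter ℕ) ≤ atTop →
      ∃ v : X, ∀ φ : StrongDual 𝕜 X, Tendsto (fun n => φ (x n)) U (𝓝 (φ v))) :
    ∃ (ψ : ℕ → ℕ) (v : X), StrictMono ψ ∧
      ∀ φ : StrongDual 𝕜 X, Tendsto (fun n => φ (x (ψ n))) atTop (𝓝 (φ v)) := by
  obtain ⟨φ, hφ⟩ := exists_countable_separating_functionals 𝕜 x
  have hcpt : IsCompact (Set.univ.pi fun k => Metric.closedBall (0 : 𝕜) (‖φ k‖ * M)) :=
    isCompact_univ_pi fun k => isCompact_closedBall _ _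
  obtain ⟨a, -, ψ, hψ, ha⟩ := hcpt.tendsto_subseq (x := fun n k => φ k (x n)) fun n k _ => by
    rw [mem_closedBall_zero_iff]
    exact (φ k).le_opNorm_of_le (hx n)
  rw [tendsto_pi_nhds] at ha
  -- Every ultrafilter limit along `ψ` lies in the closed span and takes the values `a k` on the
  -- separating functionals, so all these limits coincide.
  have key : ∀ U : Ultrafilter ℕ, (U : Filter ℕ) ≤ atTop →
      ∃ v ∈ (Submodule.span 𝕜 (Set.range x)).topologicalClosure, (∀ k, φ k v = a k) ∧
        ∀ χ : StrongDual 𝕜 X, Tendsto (fun n => χ (x (ψ n))) U (𝓝 (χ v)) := by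
    intro U hU
    obtain ⟨v, hv⟩ := h (U.map ψ) (hψ.tendsto_atTop.mono_left hU)
    refine ⟨v, mem_closure_span_of_weak_limit hv, fun k => ?_, fun χ => hv χ⟩
    exact tendsto_nhds_unique (hv (φ k)) ((ha k).mono_left hU)
  obtain ⟨v, hvG, hva, -⟩ := key (Ultrafilter.of atTop) (Ultrafilter.of_le _)
  refine ⟨ψ, v, hψ, fun χ => ?_⟩
  rw [tendsto_iff_ultrafilter]
  intro U hU
  obtain ⟨w, hwG, hwa, hw⟩ := key U hU
  have : w - v = 0 := hφ _ (Submodule.sub_mem _ hwG hvG) fun k => by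
    rw [map_sub, hwa, hva, sub_self]
  rw [← sub_eq_zero.1 this]
  exact hw χ

/-- Completeness makes the isometric image closed, so a point off it has positive distance from it.
-/
theorem exists_pos_le_norm_sub_of_norm_preserving {X Y : Type*} [NormedAddCommGroup X]
    [CompleteSpace X] [NormedAddCommGroup Y] {f : X → Y} (hf : ∀ a b, ‖f a - f b‖ = ‖a - b‖)
    {z : Y} (hz : ∀ v, f v ≠ z) :
    ∃ θ > 0, ∀ v, θ ≤ ‖z - f v‖ := by
  have hiso : Isometry f := Isometry.of_dist_eq fun a b => by
    rw [dist_eq_norm, dist_eq_norm, hf]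
  have hclosed : IsClosed (Set.range f) := hiso.isClosedEmbedding.isClosed_range
  refine ⟨_, (hclosed.notMem_iff_infDist_pos (Set.range_nonempty _)).1
    (by rintro ⟨v, hv⟩; exact hz v hv), fun v => ?_⟩
  rw [← dist_eq_norm]
  exact Metric.infDist_le_dist_of_mem ⟨v, rfl⟩

theorem norm_inclusionInDoubleDual_sub (𝕜 : Type*) [RCLike 𝕜] [NormedSpace 𝕜 X] (a b : X) :
    ‖NormedSpace.inclusionInDoubleDual 𝕜 X a - NormedSpace.inclusionInDoubleDual 𝕜 X b‖ =
      ‖a - b‖ := by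
  have h : NormedSpace.inclusionInDoubleDual 𝕜 X a - NormedSpace.inclusionInDoubleDual 𝕜 X b =
      NormedSpace.inclusionInDoubleDual 𝕜 X (a - b) := by
    ext φ
    exact (map_sub φ a b).symm
  rw [h]
  exact (NormedSpace.inclusionInDoubleDualLi (E := X) 𝕜).norm_map (a - b)

theorem exists_weakly_convergent_or_isJamesSeq (𝕜 : Type*) [RCLike 𝕜] [NormedSpace 𝕜 X]
    [CompleteSpace X] {x : ℕ → X} {M : ℝ} (hx : ∀ n, ‖x n‖ ≤ M) :
    (∃ (ψ : ℕ → ℕ) (v : X), StrictMono ψ ∧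
      ∀ φ : StrongDual 𝕜 X, Tendsto (fun n => φ (x (ψ n))) atTop (𝓝 (φ v))) ∨
    ∃ θ > 0, ∃ (ψ : ℕ → ℕ) (φ : ℕ → StrongDual 𝕜 X), IsJamesSeq θ (x ∘ ψ) φ := by
  by_cases h : ∀ U : Ultrafilter ℕ, (U : Filter ℕ) ≤ atTop →
      ∃ v : X, ∀ φ : StrongDual 𝕜 X, Tendsto (fun n => φ (x n)) U (𝓝 (φ v))
  · exact Or.inl (exists_weakly_convergent_subseq hx h)
  right
  push Not at h
  obtain ⟨U, -, hv⟩ := h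
  obtain ⟨z, hz⟩ := exists_bidual_limit 𝕜 hx U
  have hnot : ∀ v, NormedSpace.inclusionInDoubleDual 𝕜 X v ≠ z := by
    rintro v rfl
    obtain ⟨φ, hφ⟩ := hv v
    exact hφ (hz φ)
  obtain ⟨θ, hθ, hθz⟩ := exists_pos_le_norm_sub_of_norm_preserving
    (Y := StrongDual 𝕜 (StrongDual 𝕜 X)) (norm_inclusionInDoubleDual_sub 𝕜) hnot
  obtain ⟨ψ, φ, hJ⟩ := exists_isJamesSeq_of_bidual_limit hz hθ hθz
  exact ⟨θ / 2, half_pos hθ, ψ, φ, hJ⟩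

end WeakDichotomy

/-! ### Convex tails and stabilisation. -/

section ConvexTails

variable {V : Type*} [AddCommGroup V] [Module ℝ V]

/-- Eventually `y n` is a convex combination of terms of `x` with index at least `n`. -/
def IsConvexTail (y x : ℕ → V) : Prop :=
  ∀ᶠ n in atTop, y n ∈ convexHull ℝ (x '' Set.Ici n)

theorem IsConvexTail.refl (x : ℕ → V) : IsConvexTail x x :=
  Eventually.of_forall fun n => subset_convexHull ℝ _ ⟨n, Set.self_mem_Ici, rfl⟩

theorem IsConvexTail.exists_forall_mem {y x : ℕ → V} (h : IsConvexTail y x) (N : ℕ) :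
    ∃ n₀, N ≤ n₀ ∧ ∀ m ≥ n₀, y m ∈ convexHull ℝ (x '' Set.Ici N) := by
  obtain ⟨n₀, hn₀⟩ := eventually_atTop.1 h
  refine ⟨max N n₀, le_max_left _ _, fun m hm => ?_⟩
  exact convexHull_mono (Set.image_mono (Set.Ici_subset_Ici.2 ((le_max_left _ _).trans hm)))
    (hn₀ m ((le_max_right _ _).trans hm))

theorem IsConvexTail.trans {z y x : ℕ → V} (hzy : IsConvexTail z y) (hyx : IsConvexTail y x) :
    IsConvexTail z x := by
  have h := eventually_forall_ge_atTop.2 hyx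
  filter_upwards [hzy, h] with n hn hmem
  refine convexHull_min ?_ (convex_convexHull ℝ _) hn
  rintro _ ⟨m, hm, rfl⟩
  exact convexHull_mono (Set.image_mono (Set.Ici_subset_Ici.2 hm)) (hmem m hm)

/-- A nonnegative functional that decreases under passing to convex tails is constant on the
convex tails of a suitable convex tail. -/
theorem exists_isConvexTail_stable {K : Set V} {f : (ℕ → V) → ℝ}
    (hf : ∀ y, (∀ n, y n ∈ K) → 0 ≤ f y)
    (hmono : ∀ y z, (∀ n, y n ∈ K) → (∀ n, z n ∈ K) → IsConvexTail z y → f z ≤ f y)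
    {x : ℕ → V} (hx : ∀ n, x n ∈ K) :
    ∃ y, (∀ n, y n ∈ K) ∧ IsConvexTail y x ∧
      ∀ z, (∀ n, z n ∈ K) → IsConvexTail z y → f z = f y := by
  have step : ∀ (k : ℕ) (y : {y : ℕ → V // ∀ n, y n ∈ K}), ∃ z : {y : ℕ → V // ∀ n, y n ∈ K},
      IsConvexTail z.1 y.1 ∧ ∀ w : {y : ℕ → V // ∀ n, y n ∈ K}, IsConvexTail w.1 y.1 →
        f z.1 < f w.1 + 1 / ((k : ℝ) + 1) := by
    intro k y
    let S : Set ℝ := (fun w : {y : ℕ → V // ∀ n, y n ∈ K} => f w.1) '' {w | IsConvexTail w.1 y.1}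
    have hSne : S.Nonempty := ⟨_, y, IsConvexTail.refl _, rfl⟩
    have hSbdd : BddBelow S := ⟨0, by rintro _ ⟨w, -, rfl⟩; exact hf _ w.2⟩
    obtain ⟨_, ⟨z, hz, rfl⟩, hlt⟩ := exists_lt_of_csInf_lt hSne
      (lt_add_of_pos_right (sInf S) (Nat.one_div_pos_of_nat (α := ℝ) (n := k)))
    exact ⟨z, hz, fun w hw => hlt.trans_le (by gcongr; exact csInf_le hSbdd ⟨w, hw, rfl⟩)⟩
  choose g hg1 hg2 using step
  let Y : ℕ → {y : ℕ → V // ∀ n, y n ∈ K} := fun k => Nat.rec ⟨x, hx⟩ g k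
  have hYs : ∀ k, Y (k + 1) = g k (Y k) := fun k => rfl
  have hY : ∀ j k, j ≤ k → IsConvexTail (Y k).1 (Y j).1 := fun j k hjk => by
    induction k, hjk using Nat.le_induction with
    | base => exact IsConvexTail.refl _
    | succ k _ ih => rw [hYs]; exact (hg1 k (Y k)).trans ih
  -- Diagonal choice: the `k`-th term comes from `Y k` and lies in the hull of the `k`-th tail of
  -- every `Y j` with `j ≤ k`. The diagonal is thus a convex tail of `Y j` only from index `j` on,
  -- which is why the definition says "eventually".
  have hn : ∀ k, ∃ n, ∀ j ≤ k, (Y k).1 n ∈ convexHull ℝ ((Y j).1 '' Set.Ici k) := by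
    intro k
    have h1 : ∀ᶠ n in atTop, ∀ j ∈ Set.Iic k,
        (Y k).1 n ∈ convexHull ℝ ((Y j).1 '' Set.Ici k) := by
      refine (eventually_all_finite (Set.finite_Iic k)).2 fun j hj => ?_
      obtain ⟨n₀, -, h⟩ := (hY j k hj).exists_forall_mem k
      exact eventually_atTop.2 ⟨n₀, h⟩
    exact h1.exists
  choose ν hν using hn
  let z : ℕ → V := fun k => (Y k).1 (ν k)
  have hzK : ∀ n, z n ∈ K := fun n => (Y n).2 _
  have hz : ∀ j, IsConvexTail z (Y j).1 := fun j =>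
    eventually_atTop.2 ⟨j, fun k hk => hν k j hk⟩
  refine ⟨z, hzK, hz 0, fun w hwK hw => le_antisymm (hmono _ _ hzK hwK hw) ?_⟩
  refine le_of_forall_pos_lt_add fun ε hε => ?_
  obtain ⟨k, hk⟩ := exists_nat_one_div_lt hε
  have h1 := hmono _ _ (Y (k + 1)).2 hzK (hz (k + 1))
  have h2 := hg2 k (Y k) ⟨w, hwK⟩ (hw.trans (hz k))
  rw [← hYs] at h2
  exact h1.trans_lt (h2.trans (by gcongr))

end ConvexTails

/-! ### Oscillation over the unit ball. -/

section Oscillation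

variable {𝕜 E : Type*} [RCLike 𝕜] [NormedAddCommGroup E] [NormedSpace 𝕜 E]

/-- At each point of the unit ball the tails of `y` eventually have diameter at most `d`. -/
def OscLE (y : ℕ → StrongDual 𝕜 E) (d : ℝ) : Prop :=
  ∀ e : E, ‖e‖ ≤ 1 → ∃ N, ∀ p ≥ N, ∀ q ≥ N, ‖y p e - y q e‖ ≤ d

/-- The supremum over the unit ball of the oscillation of `y` at infinity. -/
noncomputable def osc (y : ℕ → StrongDual 𝕜 E) : ℝ := sInf {d | OscLE y d}

theorem OscLE.nonneg {y : ℕ → StrongDual 𝕜 E} {d : ℝ} (h : OscLE y d) : 0 ≤ d := by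
  obtain ⟨N, hN⟩ := h 0 (by simp)
  exact (norm_nonneg _).trans (hN N le_rfl N le_rfl)

theorem OscLE.mono {y : ℕ → StrongDual 𝕜 E} {d d' : ℝ} (h : OscLE y d) (hd : d ≤ d') :
    OscLE y d' := fun e he =>
  let ⟨N, hN⟩ := h e he
  ⟨N, fun p hp q hq => (hN p hp q hq).trans hd⟩

theorem bddBelow_oscLE (y : ℕ → StrongDual 𝕜 E) : BddBelow {d | OscLE y d} :=
  ⟨0, fun _ h => OscLE.nonneg h⟩

theorem OscLE.osc_le {y : ℕ → StrongDual 𝕜 E} {d : ℝ} (h : OscLE y d) : osc y ≤ d :=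
  csInf_le (bddBelow_oscLE y) h

theorem osc_nonneg (y : ℕ → StrongDual 𝕜 E) : 0 ≤ osc y :=
  Real.sInf_nonneg fun _ h => OscLE.nonneg h

theorem oscLE_of_bounded {y : ℕ → StrongDual 𝕜 E} {M : ℝ}
    (hy : ∀ n e, ‖e‖ ≤ 1 → ‖y n e‖ ≤ M) : OscLE y (M + M) := fun e he =>
  ⟨0, fun p _ q _ => (norm_sub_le _ _).trans (add_le_add (hy p e he) (hy q e he))⟩

theorem oscLE_of_osc_lt {y : ℕ → StrongDual 𝕜 E} {M d : ℝ}
    (hy : ∀ n e, ‖e‖ ≤ 1 → ‖y n e‖ ≤ M) (hd : osc y < d) : OscLE y d := by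
  obtain ⟨d', hd', hlt⟩ := exists_lt_of_csInf_lt ⟨_, oscLE_of_bounded hy⟩ hd
  exact OscLE.mono hd' hlt.le

theorem convex_setOf_norm_apply_sub_le (e : E) (a : 𝕜) (d : ℝ) :
    Convex ℝ {u : StrongDual 𝕜 E | ‖u e - a‖ ≤ d} := by
  have h := (convex_closedBall a d).is_linear_preimage (f := fun u : StrongDual 𝕜 E => u e)
    ⟨fun _ _ => rfl, fun _ _ => rfl⟩
  simpa [Set.preimage, Metric.closedBall, dist_eq_norm] using h

/-- A bound on `‖u e - v e‖` is a convex condition in each variable separately, so it passes from a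
tail to its convex hull one variable at a time. -/
theorem OscLE.of_isConvexTail {y z : ℕ → StrongDual 𝕜 E} {d : ℝ} (h : OscLE y d)
    (hz : IsConvexTail z y) : OscLE z d := by
  intro e he
  obtain ⟨N, hN⟩ := h e he
  obtain ⟨n₀, -, hn₀⟩ := hz.exists_forall_mem N
  have h1 : ∀ q ≥ N, ∀ u ∈ convexHull ℝ (y '' Set.Ici N), ‖u e - y q e‖ ≤ d := fun q hq =>
    convexHull_min (by rintro _ ⟨p, hp, rfl⟩; exact hN p hp q hq)
      (convex_setOf_norm_apply_sub_le e (y q e) d)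
  have h2 : ∀ u ∈ convexHull ℝ (y '' Set.Ici N), ∀ v ∈ convexHull ℝ (y '' Set.Ici N),
      ‖v e - u e‖ ≤ d := fun u hu =>
    convexHull_min
      (by rintro _ ⟨q, hq, rfl⟩; exact (norm_sub_rev _ _).trans_le (h1 q hq u hu))
      (convex_setOf_norm_apply_sub_le e (u e) d)
  exact ⟨n₀, fun p hp q hq => h2 _ (hn₀ q hq) _ (hn₀ p hp)⟩

theorem osc_le_of_isConvexTail {y z : ℕ → StrongDual 𝕜 E} {M : ℝ}
    (hy : ∀ n e, ‖e‖ ≤ 1 → ‖y n e‖ ≤ M) (hz : IsConvexTail z y) : osc z ≤ osc y :=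
  le_csInf ⟨_, oscLE_of_bounded hy⟩ fun _ hd => (OscLE.of_isConvexTail hd hz).osc_le

end Oscillation

/-! ### Dyadic trees and the `ℓ₁` lower bound. -/

section Splitting

variable {𝕜 E : Type*} [RCLike 𝕜] [NormedAddCommGroup E] [NormedSpace 𝕜 E]

/-- If the average of the real parts of `α t - β t` is nearly the common upper bound `δ` of the
moduli of all the `α t - β t'`, then all these real parts are nearly `δ`. -/
theorem le_of_average_le {ι : Type*} [Fintype ι] {r : ι → ι → ℝ} {δ ε : ℝ}
    (hr : ∀ t t', r t t' ≤ δ + ε) (hcross : ∀ t t', r t t' + r t' t = r t t + r t' t')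
    (havg : Fintype.card ι * (δ - ε) ≤ ∑ t, r t t) (t t' : ι) :
    δ + ε - 4 * Fintype.card ι * ε ≤ r t t' := by
  -- The deficits `δ + ε - r v v` are nonnegative and sum to at most `2 * Fintype.card ι * ε`, so
  -- each obeys this bound.
  have hdiag : ∀ u, δ + ε - 2 * Fintype.card ι * ε ≤ r u u := fun u => by
    have h1 : δ + ε - r u u ≤ ∑ v, (δ + ε - r v v) :=
      Finset.single_le_sum (f := fun v => δ + ε - r v v) (fun v _ => sub_nonneg.2 (hr v v))
        (Finset.mem_univ u)
    rw [Finset.sum_sub_distrib, Finset.sum_const, Finset.card_univ, nsmul_eq_mul] at h1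
    linarith
  have h1 := hdiag t
  have h2 := hdiag t'
  have h3 := hcross t t'
  have h4 := hr t' t
  linarith

theorem average_mem_of_convex {V ι : Type*} [AddCommGroup V] [Module ℝ V] [Fintype ι] [Nonempty ι]
    {K : Set V} (hK : Convex ℝ K) {v : ι → V} (hv : ∀ t, v t ∈ K) :
    ∑ t, (Fintype.card ι : ℝ)⁻¹ • v t ∈ K :=
  hK.sum_mem (fun _ _ => by positivity)
    (by rw [Finset.sum_const, Finset.card_univ, nsmul_eq_mul, mul_inv_cancel₀ (by positivity)])
    fun t _ => hv t

/-- If the oscillation of `y` is stable under convex tails, then finitely many subsequences of `y`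
can be split simultaneously by one point of the unit ball. -/
theorem exists_simultaneous_split {K : Set (StrongDual 𝕜 E)} (hK : Convex ℝ K)
    {y : ℕ → StrongDual 𝕜 E} {M : ℝ} (hyK : ∀ n, y n ∈ K) (hy : ∀ n e, ‖e‖ ≤ 1 → ‖y n e‖ ≤ M)
    (hst : ∀ z, (∀ n, z n ∈ K) → IsConvexTail z y → osc z = osc y)
    {ι : Type*} [Fintype ι] [Nonempty ι] {s : ι → ℕ → ℕ} (hs : ∀ t n, n ≤ s t n)
    {η : ℝ} (hη : 0 < η) :
    ∃ e : E, ‖e‖ ≤ 1 ∧ ∃ p q : ℕ → ℕ, (∀ n, n ≤ p n) ∧ (∀ n, n ≤ q n) ∧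
      ∀ t t', ∀ᶠ n : ℕ × ℕ in atTop ×ˢ atTop,
        osc y - η < RCLike.re (y (s t (p n.1)) e - y (s t' (q n.2)) e) := by
  set δ := osc y with hδ
  set N : ℝ := (Fintype.card ι : ℝ) with hN
  have hN0 : 0 < N := by positivity
  -- The loss in `le_of_average_le` is `(4 * N - 1) * ε`, which has to stay below `η`.
  set ε : ℝ := η / (4 * N + 2) with hε
  have hε0 : 0 < ε := by positivity
  have hεη : (4 * N + 1) * ε < η := by
    rw [hε, mul_div_assoc', div_lt_iff₀ (by positivity)]
    nlinarith
  let w : ℕ → StrongDual 𝕜 E := fun n => ∑ t, N⁻¹ • y (s t n)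
  have hwK : ∀ n, w n ∈ K := fun n => average_mem_of_convex hK fun t => hyK _
  have hwy : IsConvexTail w y := Eventually.of_forall fun n =>
    average_mem_of_convex (convex_convexHull ℝ _) fun t =>
      subset_convexHull ℝ _ ⟨s t n, hs t n, rfl⟩
  have hwe : ∀ n e, w n e = ∑ t, N⁻¹ • y (s t n) e := fun n e => by
    simp [w]
  -- The average `w` is a convex tail of `y`, so stability forbids any drop of its oscillation.
  have hosc : ¬ OscLE w (δ - ε) := fun h => by
    have := h.osc_le
    rw [hst w hwK hwy] at this
    linarith
  unfold OscLE at hosc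
  push Not at hosc
  obtain ⟨e, he, hpq⟩ := hosc
  choose p hp q hq hpq using hpq
  obtain ⟨N₀, hN₀⟩ := oscLE_of_osc_lt hy (lt_add_of_pos_right δ hε0) e he
  obtain ⟨a, -, ψ, hψ, ha⟩ := tendsto_subseq_of_bounded
    (Metric.isBounded_closedBall (x := (0 : ι → 𝕜 × 𝕜)) (r := M))
    (x := fun n t => (y (s t (p n)) e, y (s t (q n)) e)) fun n => by
      rw [mem_closedBall_zero_iff, pi_norm_le_iff_of_nonempty]
      exact fun t => max_le (hy _ e he) (hy _ e he)
  rw [tendsto_pi_nhds] at ha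
  have hα : ∀ t, Tendsto (fun n => y (s t (p (ψ n))) e) atTop (𝓝 (a t).1) := fun t =>
    (continuous_fst.tendsto _).comp (ha t)
  have hβ : ∀ t, Tendsto (fun n => y (s t (q (ψ n))) e) atTop (𝓝 (a t).2) := fun t =>
    (continuous_snd.tendsto _).comp (ha t)
  have hub : ∀ t t', ‖(a t).1 - (a t').2‖ ≤ δ + ε := fun t t' => by
    refine le_of_tendsto ((hα t).sub (hβ t')).norm ?_
    filter_upwards [eventually_ge_atTop N₀] with n hn
    have hn' := hn.trans hψ.le_apply
    exact hN₀ _ (hn'.trans ((hp _).trans (hs _ _))) _ (hn'.trans ((hq _).trans (hs _ _)))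
  set m : 𝕜 := ∑ t, N⁻¹ • ((a t).1 - (a t).2) with hm
  have hlb : δ - ε ≤ ‖m‖ := by
    have h1 : Tendsto (fun n => w (p (ψ n)) e - w (q (ψ n)) e) atTop (𝓝 m) := by
      simp only [hwe, ← Finset.sum_sub_distrib, ← smul_sub]
      exact tendsto_finsetSum _ fun t _ => ((hα t).sub (hβ t)).const_smul _
    exact ge_of_tendsto' h1.norm fun n => (hpq (ψ n)).le
  -- Rotating by `u` makes the averaged difference real and positive; the rotation is finally
  -- absorbed into `e`.
  obtain ⟨u, hu, hum⟩ := RCLike.exists_norm_eq_mul_self m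
  have hre := le_of_average_le (r := fun t t' => RCLike.re (u * ((a t).1 - (a t').2)))
    (δ := δ) (ε := ε)
    (fun t t' => (RCLike.re_le_norm _).trans (by rw [norm_mul, hu, one_mul]; exact hub t t'))
    (fun t t' => by rw [← map_add, ← map_add]; congr 1; ring)
    (by
      have h1 : ∑ t, RCLike.re (u * ((a t).1 - (a t).2)) = N * ‖m‖ := by
        have h2 : N * ‖m‖ = RCLike.re (u * (N • m)) := by
          rw [mul_smul_comm, ← hum, RCLike.smul_re, RCLike.ofReal_re]
        rw [h2, hm, ← Finset.smul_sum, smul_inv_smul₀ hN0.ne', Finset.mul_sum, map_sum]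
      rw [h1]
      gcongr)
  refine ⟨u • e, by rw [norm_smul, hu, one_mul]; exact he, p ∘ ψ, q ∘ ψ,
    fun n => hψ.le_apply.trans (hp _), fun n => hψ.le_apply.trans (hq _), fun t t' => ?_⟩
  have hlim : Tendsto (fun n : ℕ × ℕ => RCLike.re (u *
      (y (s t (p (ψ n.1))) e - y (s t' (q (ψ n.2))) e))) (atTop ×ˢ atTop)
      (𝓝 (RCLike.re (u * ((a t).1 - (a t').2)))) :=
    (RCLike.continuous_re.tendsto _).comp
      ((((hα t).comp tendsto_fst).sub ((hβ t').comp tendsto_snd)).const_mul u)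
  have hlt : δ - η < RCLike.re (u * ((a t).1 - (a t').2)) :=
    lt_of_lt_of_le (by linarith) (hre t t')
  filter_upwards [hlim.eventually_const_lt hlt] with n hn
  simpa only [Function.comp_apply, map_smul, smul_eq_mul, ← mul_sub] using hn

/-- The first `k` points of `e` split `2 ^ k` subsequences of `y` in all possible ways. -/
def SplitsTree (y : ℕ → StrongDual 𝕜 E) (d : ℝ) (k : ℕ) (e : ℕ → E) : Prop :=
  ∃ s : (Fin k → Bool) → ℕ → ℕ, (∀ t n, n ≤ s t n) ∧
    ∀ (i : Fin k) (t t' : Fin k → Bool), t i = true → t' i = false →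
      ∀ᶠ n : ℕ × ℕ in atTop ×ˢ atTop, d < RCLike.re (y (s t n.1) (e i) - y (s t' n.2) (e i))

theorem splitsTree_zero (y : ℕ → StrongDual 𝕜 E) (d : ℝ) (e : ℕ → E) : SplitsTree y d 0 e :=
  ⟨fun _ n => n, fun _ _ => le_rfl, fun i => i.elim0⟩

/-- One new point splits all `2 ^ k` subsequences simultaneously; reindexing each along `p` or along
`q` doubles their number. Old splittings survive because they hold for independent large indices. -/
theorem SplitsTree.exists_succ {K : Set (StrongDual 𝕜 E)} (hK : Convex ℝ K)
    {y : ℕ → StrongDual 𝕜 E} {M : ℝ} (hyK : ∀ n, y n ∈ K) (hy : ∀ n e, ‖e‖ ≤ 1 → ‖y n e‖ ≤ M)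
    (hst : ∀ z, (∀ n, z n ∈ K) → IsConvexTail z y → osc z = osc y)
    {η : ℝ} (hη : 0 < η) {k : ℕ} {e : ℕ → E} (h : SplitsTree y (osc y - η) k e) :
    ∃ v : E, ‖v‖ ≤ 1 ∧ ∀ e' : ℕ → E, (∀ i < k, e' i = e i) → e' k = v →
      SplitsTree y (osc y - η) (k + 1) e' := by
  obtain ⟨s, hs, hsplit⟩ := h
  obtain ⟨v, hv, p, q, hp, hq, hpq⟩ := exists_simultaneous_split hK hyK hy hst hs hη
  refine ⟨v, hv, fun e' he' hev => ?_⟩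
  let r : Bool → ℕ → ℕ := fun b => if b then p else q
  have hr : ∀ b n, n ≤ r b n := fun b n => by
    cases b
    · exact hq n
    · exact hp n
  have hrt : ∀ b, Tendsto (r b) atTop atTop := fun b => tendsto_atTop_mono (hr b) tendsto_id
  refine ⟨fun t n => s (Fin.init t) (r (t (Fin.last k)) n),
    fun t n => (hr _ n).trans (hs _ _), fun i t t' ht htf => ?_⟩
  induction i using Fin.lastCases with
  | last =>
    simp only [ht, htf, Fin.val_last, hev]
    exact hpq (Fin.init t) (Fin.init t')
  | cast i =>
    rw [Fin.val_castSucc, he' i i.2]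
    exact ((hrt _).prodMap (hrt _)).eventually (hsplit i (Fin.init t) (Fin.init t') ht htf)

/-- Dependent choice of a sequence whose initial segments satisfy a given property. -/
theorem exists_seq_of_forall_extend {α : Type*} [Nonempty α] {P : ℕ → (ℕ → α) → Prop}
    {Q : α → Prop} (h0 : ∀ e, P 0 e)
    (hstep : ∀ k e, P k e → ∃ v, Q v ∧ ∀ e' : ℕ → α, (∀ i < k, e' i = e i) → e' k = v →
      P (k + 1) e') :
    ∃ e : ℕ → α, (∀ k, Q (e k)) ∧ ∀ k, P k e := by
  choose g hgQ hgP using hstep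
  let next : ∀ k, {e // P k e} → {e // P (k + 1) e} := fun k e =>
    ⟨Function.update e.1 k (g k e.1 e.2), hgP k e.1 e.2 _
      (fun i hi => Function.update_of_ne hi.ne _ _) (Function.update_self _ _ _)⟩
  let Y : ∀ k, {e // P k e} := fun k =>
    Nat.rec ⟨fun _ => Classical.arbitrary α, h0 _⟩ next k
  let e : ℕ → α := fun k => g k (Y k).1 (Y k).2
  -- Stage `k` alters position `k` only, so earlier entries are final.
  have hY : ∀ k, ∀ i < k, e i = (Y k).1 i := fun k => by
    induction k with
    | zero => intro i hi; omega
    | succ k ih =>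
      intro i hi
      change e i = Function.update (Y k).1 k (e k) i
      rcases Nat.lt_succ_iff_lt_or_eq.1 hi with h | rfl
      · rw [Function.update_of_ne h.ne, ih i h]
      · rw [Function.update_self]
  refine ⟨e, fun k => hgQ k _ _, fun k => ?_⟩
  cases k with
  | zero => exact h0 e
  | succ k => exact hgP k (Y k).1 (Y k).2 e (hY k) rfl

/-- The branch `t` and its complement disagree at every level, so the difference of far terms of
these two subsequences has the prescribed sign at each `e i`. -/
theorem SplitsTree.exists_functional {y : ℕ → StrongDual 𝕜 E} {M d d' : ℝ}
    (hy : ∀ n, ‖y n‖ ≤ M) (hd' : OscLE y d') {k : ℕ} {e : ℕ → E} (he : ∀ i, ‖e i‖ ≤ 1)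
    (h : SplitsTree y d k e) (t : ℕ → Bool) :
    ∃ g : StrongDual 𝕜 E, (∀ v, ‖g v‖ ≤ 2 * M * ‖v‖) ∧ ∀ i < k, ‖g (e i)‖ ≤ d' ∧
      d < (if t i then 1 else -1) * RCLike.re (g (e i)) := by
  obtain ⟨s, hs, hsplit⟩ := h
  let τ : Fin k → Bool := fun i => t i
  let τ' : Fin k → Bool := fun i => !t i
  have hst : ∀ t, Tendsto (s t) atTop atTop := fun t => tendsto_atTop_mono (hs t) tendsto_id
  have hev : ∀ᶠ n : ℕ × ℕ in atTop ×ˢ atTop, ∀ i : Fin k,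
      ‖y (s τ n.1) (e i) - y (s τ' n.2) (e i)‖ ≤ d' ∧
      d < (if t i then 1 else -1) * RCLike.re (y (s τ n.1) (e i) - y (s τ' n.2) (e i)) := by
    refine eventually_all.2 fun i => Eventually.and ?_ ?_
    · obtain ⟨N, hN⟩ := hd' (e i) (he i)
      filter_upwards [((hst τ).eventually_ge_atTop N).prod_mk
        ((hst τ').eventually_ge_atTop N)] with n hn
      exact hN _ hn.1 _ hn.2
    · cases hti : t i with
      | true =>
        filter_upwards [hsplit i τ τ' hti (by simp [τ', hti])] with n hn
        simpa using hn
      | false =>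
        have h1 := hsplit i τ' τ (by simp [τ', hti]) hti
        filter_upwards [Filter.eventually_swap_iff.1 h1] with n hn
        simp only [Prod.fst_swap, Prod.snd_swap] at hn
        simp only [Bool.false_eq_true, if_false, neg_mul, one_mul, ← map_neg, neg_sub]
        exact hn
  obtain ⟨n, hn⟩ := hev.exists
  refine ⟨y (s τ n.1) - y (s τ' n.2), fun v => ?_, fun i hi => hn ⟨i, hi⟩⟩
  calc ‖y (s τ n.1) v - y (s τ' n.2) v‖ ≤ ‖y (s τ n.1) v‖ + ‖y (s τ' n.2) v‖ := norm_sub_le _ _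
    _ ≤ M * ‖v‖ + M * ‖v‖ := add_le_add ((y _).le_of_opNorm_le (hy _) v)
        ((y _).le_of_opNorm_le (hy _) v)
    _ = 2 * M * ‖v‖ := by ring

/-- Pythagoras with `(17/16)² - (15/16)² = (1/2)²`; this explains the tolerance `δ / 16`. -/
theorem abs_im_le_half {z : 𝕜} {δ : ℝ} (hδ : 0 < δ) (hz : ‖z‖ ≤ δ + δ / 16)
    (hre : δ - δ / 16 ≤ |RCLike.re z|) : |RCLike.im z| ≤ δ / 2 := by
  have h1 : ‖z‖ ^ 2 = RCLike.re z ^ 2 + RCLike.im z ^ 2 := by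
    rw [RCLike.norm_sq_eq_def, sq, sq]
  have h2 : ‖z‖ ^ 2 ≤ (δ + δ / 16) ^ 2 := by gcongr
  have h3 : (δ - δ / 16) ^ 2 ≤ RCLike.re z ^ 2 := by
    rw [← sq_abs (RCLike.re z)]
    have : 0 ≤ δ - δ / 16 := by linarith
    gcongr
  exact abs_le_of_sq_le_sq (by nlinarith) (by positivity)

theorem lower_bound_mul {σ a b r s δ : ℝ} (hσa : σ * a = |a|) (hσ : |σ| = 1)
    (hr : δ - δ / 16 < σ * r) (hs : |s| ≤ δ / 2) :
    15 / 16 * δ * |a| - δ / 2 * |b| ≤ a * r - b * s ∧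
    15 / 16 * δ * |a| - δ / 2 * |b| ≤ a * r + b * s := by
  have hσσ : σ * σ = 1 := by rw [← abs_mul_abs_self, hσ, one_mul]
  have h1 : a * r = |a| * (σ * r) := by
    rw [← hσa]
    linear_combination -(a * r) * hσσ
  have h2 : 15 / 16 * δ * |a| ≤ a * r := by
    rw [h1, mul_comm]
    exact mul_le_mul_of_nonneg_left (by linarith) (abs_nonneg a)
  have h3 : |b * s| ≤ δ / 2 * |b| := by
    rw [abs_mul, mul_comm]
    gcongr
  have h4 := abs_le.1 h3
  exact ⟨by linarith, by linarith⟩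

/-- The signs of `g` are matched to the real or the imaginary parts of `c`, whichever have the
larger sum. The matched parts contribute at least `15/16 * δ` times their sum and the others spoil
at most `δ / 2` times theirs, leaving `7/16 * δ * max A B`. -/
theorem lower_bound_of_splitsTree {y : ℕ → StrongDual 𝕜 E} {M δ : ℝ} (hM : 0 < M) (hδ : 0 < δ)
    (hy : ∀ n, ‖y n‖ ≤ M) (hosc : OscLE y (δ + δ / 16)) {k : ℕ} {e : ℕ → E}
    (he : ∀ i, ‖e i‖ ≤ 1) (h : SplitsTree y (δ - δ / 16) k e) (c : ℕ → 𝕜) :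
    δ / (16 * M) * ∑ i ∈ Finset.range k, ‖c i‖ ≤ ‖∑ i ∈ Finset.range k, c i • e i‖ := by
  set A := ∑ i ∈ Finset.range k, |RCLike.re (c i)| with hA
  set B := ∑ i ∈ Finset.range k, |RCLike.im (c i)| with hB
  have hAB : ∑ i ∈ Finset.range k, ‖c i‖ ≤ A + B := by
    rw [hA, hB, ← Finset.sum_add_distrib]
    refine Finset.sum_le_sum fun i _ => ?_
    conv_lhs => rw [← RCLike.re_add_im (c i)]
    refine (norm_add_le _ _).trans (add_le_add (RCLike.norm_ofReal _).le ?_)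
    rw [norm_mul, RCLike.norm_ofReal]
    exact mul_le_of_le_one_right (abs_nonneg _) (by rw [RCLike.norm_I]; split_ifs <;> norm_num)
  set v := ∑ i ∈ Finset.range k, c i • e i with hv
  have hsign : ∀ a : ℝ, (if decide (0 ≤ a) then (1 : ℝ) else -1) * a = |a| := fun a => by
    by_cases ha : 0 ≤ a
    · simp [ha, abs_of_nonneg ha]
    · simp [ha, abs_of_neg (not_le.1 ha)]
  have hsign1 : ∀ b : Bool, |(if b then (1 : ℝ) else -1)| = 1 := fun b => by cases b <;> simp
  have hreabs : ∀ (b : Bool) (r : ℝ), δ - δ / 16 < (if b then 1 else -1) * r →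
      δ - δ / 16 ≤ |r| := fun b r hr => by
    calc δ - δ / 16 ≤ |(if b then 1 else -1) * r| := hr.le.trans (le_abs_self _)
      _ = |r| := by rw [abs_mul, hsign1, one_mul]
  suffices hmain : 7 / 16 * δ * max A B ≤ 2 * M * ‖v‖ by
    have h1 : A + B ≤ 2 * max A B := by linarith [le_max_left A B, le_max_right A B]
    rw [div_mul_eq_mul_div, div_le_iff₀ (by positivity)]
    have h2 : δ * ∑ i ∈ Finset.range k, ‖c i‖ ≤ δ * (2 * max A B) := by
      gcongr
      exact hAB.trans h1
    have h3 : 0 ≤ M * ‖v‖ := by positivity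
    linarith
  have hgv : ∀ g : StrongDual 𝕜 E, g v = ∑ i ∈ Finset.range k, c i * g (e i) := fun g => by
    simp [hv, map_sum]
  rcases le_total B A with hle | hle
  · rw [max_eq_left hle]
    obtain ⟨g, hg, hgi⟩ := h.exists_functional hy hosc he fun i => decide (0 ≤ RCLike.re (c i))
    refine le_trans ?_ (hg v)
    refine le_trans ?_ (RCLike.re_le_norm (g v))
    have h1 : 15 / 16 * δ * A - δ / 2 * B ≤ RCLike.re (g v) := by
      rw [hgv, map_sum, hA, hB, Finset.mul_sum, Finset.mul_sum, ← Finset.sum_sub_distrib]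
      refine Finset.sum_le_sum fun i hi => ?_
      obtain ⟨h1, h2⟩ := hgi i (Finset.mem_range.1 hi)
      rw [RCLike.mul_re]
      exact (lower_bound_mul (hsign _) (hsign1 _) h2 (abs_im_le_half hδ h1 (hreabs _ _ h2))).1
    have : δ * B ≤ δ * A := by gcongr
    linarith
  · rw [max_eq_right hle]
    obtain ⟨g, hg, hgi⟩ := h.exists_functional hy hosc he fun i => decide (0 ≤ RCLike.im (c i))
    refine le_trans ?_ (hg v)
    refine le_trans ?_ (RCLike.im_le_norm (g v))
    have h1 : 15 / 16 * δ * B - δ / 2 * A ≤ RCLike.im (g v) := by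
      rw [hgv, map_sum, hA, hB, Finset.mul_sum, Finset.mul_sum, ← Finset.sum_sub_distrib]
      refine Finset.sum_le_sum fun i hi => ?_
      obtain ⟨h1, h2⟩ := hgi i (Finset.mem_range.1 hi)
      rw [RCLike.mul_im, add_comm]
      exact (lower_bound_mul (hsign _) (hsign1 _) h2 (abs_im_le_half hδ h1 (hreabs _ _ h2))).2
    have : δ * A ≤ δ * B := by gcongr
    linarith

/-- In the dual of a space without copies of `ℓ₁`, every bounded sequence has a weak*-Cauchy
sequence of convex combinations of its tails. -/
theorem exists_weakStar_cauchy_isConvexTail [CompleteSpace E] (hE : ¬ ContainsCopyEllOne 𝕜 E)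
    {x : ℕ → StrongDual 𝕜 E} {M : ℝ} (hx : ∀ n, ‖x n‖ ≤ M) :
    ∃ y : ℕ → StrongDual 𝕜 E, (∀ n, y n ∈ convexHull ℝ (Set.range x)) ∧ IsConvexTail y x ∧
      ∀ e, CauchySeq fun n => y n e := by
  set K : Set (StrongDual 𝕜 E) := convexHull ℝ (Set.range x) with hKdef
  have hK : Convex ℝ K := convex_convexHull ℝ _
  have hM : 0 < |M| + 1 := by positivity
  have hKM : ∀ u ∈ K, ‖u‖ ≤ |M| + 1 := by
    intro u hu
    have h1 : K ⊆ Metric.closedBall (0 : StrongDual 𝕜 E) (|M| + 1) := by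
      refine convexHull_min ?_ (convex_closedBall _ _)
      rintro _ ⟨n, rfl⟩
      exact mem_closedBall_zero_iff.2 ((hx n).trans (by linarith [le_abs_self M]))
    exact mem_closedBall_zero_iff.1 (h1 hu)
  have hKe : ∀ y : ℕ → StrongDual 𝕜 E, (∀ n, y n ∈ K) →
      ∀ n e, ‖e‖ ≤ 1 → ‖y n e‖ ≤ |M| + 1 := fun y hyK n e he =>
    (y n).le_of_opNorm_le_of_le (hKM _ (hyK n)) he |>.trans_eq (mul_one _)
  obtain ⟨y, hyK, hyx, hst⟩ := exists_isConvexTail_stable (K := K) (f := osc)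
    (fun y _ => osc_nonneg y)
    (fun y z hyK _ hzy => osc_le_of_isConvexTail (hKe y hyK) hzy)
    (fun n => subset_convexHull ℝ _ ⟨n, rfl⟩)
  refine ⟨y, hyK, hyx, ?_⟩
  rcases (osc_nonneg y).eq_or_lt with h0 | hδ
  · have hball : ∀ e : E, ‖e‖ ≤ 1 → CauchySeq fun n => y n e := fun e he => by
      rw [Metric.cauchySeq_iff]
      intro ε hε
      obtain ⟨N, hN⟩ := oscLE_of_osc_lt (hKe y hyK) (d := ε / 2) (by rw [← h0]; positivity) e he
      refine ⟨N, fun p hp q hq => ?_⟩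
      rw [dist_eq_norm]
      exact (hN p hp q hq).trans_lt (half_lt_self hε)
    intro e
    -- Dividing by `‖e‖ + 1` brings `e` into the ball, also when `e = 0`.
    have hne : ((‖e‖ + 1 : ℝ) : 𝕜) ≠ 0 := by
      rw [RCLike.ofReal_ne_zero]; positivity
    have h1 := hball (((‖e‖ + 1 : ℝ) : 𝕜)⁻¹ • e) (by
      rw [norm_smul, norm_inv, RCLike.norm_ofReal, abs_of_pos (by positivity), inv_mul_eq_div,
        div_le_one (by positivity)]
      linarith)
    have h2 := (uniformContinuous_const_smul ((‖e‖ + 1 : ℝ) : 𝕜)).comp_cauchySeq h1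
    convert h2 using 2 with n
    rw [Function.comp_apply, map_smul, smul_inv_smul₀ hne]
  · exfalso
    obtain ⟨e, he, htree⟩ := exists_seq_of_forall_extend (α := E) (Q := fun v => ‖v‖ ≤ 1)
      (splitsTree_zero y (osc y - osc y / 16))
      fun k e hk => hk.exists_succ hK hyK (hKe y hyK) hst (by positivity)
    refine hE (containsCopyEllOne_of_lower_bound he (κ := osc y / (16 * (|M| + 1)))
      (by positivity) fun k c => ?_)
    exact lower_bound_of_splitsTree hM hδ (fun n => hKM _ (hyK n))
      (oscLE_of_osc_lt (hKe y hyK) (by linarith)) he (htree k) c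

end Splitting

/-! ### Existence of a weak*-null sequence that is not norm null. -/

section Nonempty

variable {𝕜 E : Type*} [RCLike 𝕜] [NormedAddCommGroup E] [NormedSpace 𝕜 E]

theorem convexHull_subset_submodule (F : Submodule 𝕜 (StrongDual 𝕜 E))
    {s : Set (StrongDual 𝕜 E)} (hs : s ⊆ F) : convexHull ℝ s ⊆ (F : Set (StrongDual 𝕜 E)) := by
  have hsmul : ∀ (r : ℝ) (u : StrongDual 𝕜 E), r • u = (r : 𝕜) • u := fun r u => by
    ext v
    exact RCLike.real_smul_eq_coe_mul r (u v)
  refine convexHull_min hs fun u hu v hv a b _ _ _ => ?_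
  rw [hsmul, hsmul]
  exact F.add_mem (F.smul_mem _ hu) (F.smul_mem _ hv)

theorem weakStarNullNotNormNull_nonempty_of_seq {F : Submodule 𝕜 (StrongDual 𝕜 E)}
    {z : ℕ → StrongDual 𝕜 E} (hzF : ∀ n, z n ∈ F) {M c : ℝ} (hzM : ∀ n, ‖z n‖ ≤ M) (hc : 0 < c)
    (hzc : ∀ n, c ≤ ‖z n‖) (hz : ∀ e, Tendsto (fun n => z n e) atTop (𝓝 0)) :
    (weakStarNullNotNormNull F).Nonempty := by
  refine ⟨⟨fun n => ⟨z n, hzF n⟩, memℓp_infty ⟨M, ?_⟩⟩,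
    mem_weakStarNullNotNormNull_iff.2 ⟨hz, fun h => ?_⟩⟩
  · rintro _ ⟨n, rfl⟩
    exact hzM n
  · exact absurd (ge_of_tendsto' h hzc) (not_le.2 hc)

theorem CauchySeq.tendsto_sub_zero {u : ℕ → 𝕜} (hu : CauchySeq u) {m : ℕ → ℕ}
    (hm : ∀ n, n ≤ m n) : Tendsto (fun n => u (m n) - u n) atTop (𝓝 0) := by
  rw [Metric.cauchySeq_iff] at hu
  rw [Metric.tendsto_atTop]
  intro ε hε
  obtain ⟨N, hN⟩ := hu ε hε
  refine ⟨N, fun n hn => ?_⟩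
  rw [dist_zero_right, ← dist_eq_norm]
  exact hN _ (hn.le.trans (hm n)) _ hn

/-- Convex tails of a sequence separated in the manner of James are not norm Cauchy. -/
theorem IsJamesSeq.exists_le_norm_sub {x y : ℕ → StrongDual 𝕜 E} {θ : ℝ}
    {φ : ℕ → StrongDual 𝕜 (StrongDual 𝕜 E)} (h : IsJamesSeq θ x φ)
    (hy : ∀ n, y n ∈ convexHull ℝ (Set.range x)) (hyx : IsConvexTail y x) (n : ℕ) :
    ∃ m ≥ n, θ ≤ ‖y m - y n‖ := by
  obtain ⟨hφ1, hφ0, hφθ⟩ := h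
  have hsmul : ∀ (j : ℕ) (r : ℝ) (u : StrongDual 𝕜 E), φ j (r • u) = r • φ j u := fun j r u => by
    have : r • u = (r : 𝕜) • u := by
      ext v
      exact RCLike.real_smul_eq_coe_mul r (u v)
    rw [this, map_smul, smul_eq_mul, RCLike.real_smul_eq_coe_mul]
  -- Being a finite convex combination, `y n` is killed by all late `φ i`, whereas `φ j` is at least
  -- `θ` in real part on hulls of terms from `j` on.
  obtain ⟨j, hj⟩ : ∃ j, ∀ i ≥ j, φ i (y n) = 0 := by
    have hsub : convexHull ℝ (Set.range x) ⊆ {u | ∃ j, ∀ i ≥ j, φ i u = 0} := by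
      refine convexHull_min ?_ ?_
      · rintro _ ⟨k, rfl⟩
        exact ⟨k + 1, fun i hi => hφ0 i k hi⟩
      · rintro u ⟨j, hj⟩ v ⟨k, hk⟩ a b _ _ _
        refine ⟨max j k, fun i hi => ?_⟩
        rw [map_add, hsmul, hsmul, hj i ((le_max_left _ _).trans hi),
          hk i ((le_max_right _ _).trans hi), smul_zero, smul_zero, add_zero]
    exact hsub (hy n)
  obtain ⟨n₀, -, hn₀⟩ := hyx.exists_forall_mem j
  refine ⟨max n n₀, le_max_left _ _, ?_⟩
  have h1 : θ ≤ RCLike.re (φ j (y (max n n₀))) := by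
    have hsub : convexHull ℝ (x '' Set.Ici j) ⊆ {u | θ ≤ RCLike.re (φ j u)} := by
      refine convexHull_min ?_ ?_
      · rintro _ ⟨k, hk, rfl⟩
        exact hφθ j k hk
      · intro u hu v hv a b ha hb hab
        simp only [Set.mem_ofPred_eq, map_add, hsmul, RCLike.smul_re] at hu hv ⊢
        calc θ = a * θ + b * θ := by rw [← add_mul, hab, one_mul]
          _ ≤ _ := by gcongr
    exact hsub (hn₀ _ (le_max_right _ _))
  calc θ ≤ RCLike.re (φ j (y (max n n₀) - y n)) := by rwa [map_sub, hj j le_rfl, sub_zero]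
    _ ≤ ‖φ j (y (max n n₀) - y n)‖ := RCLike.re_le_norm _
    _ ≤ 1 * ‖y (max n n₀) - y n‖ := (φ j).le_of_opNorm_le (hφ1 j) _
    _ = _ := one_mul _

theorem weakStarNullNotNormNull_nonempty [CompleteSpace E] (hE : ¬ ContainsCopyEllOne 𝕜 E)
    {F : Submodule 𝕜 (StrongDual 𝕜 E)} (hFinf : ¬ FiniteDimensional 𝕜 F) :
    (weakStarNullNotNormNull F).Nonempty := by
  obtain ⟨R, f, -, hfR, hf⟩ := exists_seq_norm_le_one_le_norm_sub (𝕜 := 𝕜) (E := F) hFinf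
  let x : ℕ → StrongDual 𝕜 E := fun n => f n
  have hxR : ∀ n, ‖x n‖ ≤ R := hfR
  have hx1 : ∀ m n, m ≠ n → 1 ≤ ‖x m - x n‖ := fun m n hmn => hf hmn
  have hxF : ∀ n, x n ∈ F := fun n => (f n).2
  rcases exists_weakly_convergent_or_isJamesSeq 𝕜 hxR with
    ⟨ψ, v, hψ, hlim⟩ | ⟨θ, hθ, ψ, φ, hJ⟩
  · refine weakStarNullNotNormNull_nonempty_of_seq (z := fun n => x (ψ (n + 1)) - x (ψ n))
      (fun n => F.sub_mem (hxF _) (hxF _))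
      (fun n => (norm_sub_le _ _).trans (add_le_add (hxR _) (hxR _))) one_pos
      (fun n => hx1 _ _ (hψ (Nat.lt_succ_self n)).ne') fun e => ?_
    -- Only evaluations at points of `E` are needed from weak convergence in `E*`.
    exact (hlim (NormedSpace.inclusionInDoubleDual 𝕜 E e)).cauchySeq.tendsto_sub_zero
      (m := fun n => n + 1) fun n => Nat.le_succ n
  · obtain ⟨y, hy, hyx, hcauchy⟩ := exists_weakStar_cauchy_isConvexTail hE
      (x := x ∘ ψ) fun n => hxR (ψ n)
    have hyF : ∀ n, y n ∈ F := fun n =>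
      convexHull_subset_submodule F (by rintro _ ⟨k, rfl⟩; exact hxF _) (hy n)
    have hyR : ∀ n, ‖y n‖ ≤ R := fun n => by
      have h1 : convexHull ℝ (Set.range (x ∘ ψ)) ⊆ Metric.closedBall (0 : StrongDual 𝕜 E) R :=
        convexHull_min (by rintro _ ⟨k, rfl⟩; exact mem_closedBall_zero_iff.2 (hxR _))
          (convex_closedBall _ _)
      exact mem_closedBall_zero_iff.1 (h1 (hy n))
    choose m hm hmθ using hJ.exists_le_norm_sub hy hyx
    exact weakStarNullNotNormNull_nonempty_of_seq (z := fun n => y (m n) - y n)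
      (fun n => F.sub_mem (hyF _) (hyF _))
      (fun n => (norm_sub_le _ _).trans (add_le_add (hyR _) (hyR _))) hθ hmθ
      fun e => (hcauchy e).tendsto_sub_zero hm

end Nonempty

theorem corollary3p6 {𝕜 E : Type*} [RCLike 𝕜] [NormedAddCommGroup E] [NormedSpace 𝕜 E]
    [CompleteSpace E] (hE : ¬ ContainsCopyEllOne 𝕜 E)
    (F : Submodule 𝕜 (StrongDual 𝕜 E)) (hF : IsClosed (F : Set (StrongDual 𝕜 E)))
    (hFinf : ¬ FiniteDimensional 𝕜 F) :
    AlmostPointwiseSpaceable 𝕜 (weakStarNullNotNormNull F) :=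
  ⟨weakStarNullNotNormNull_nonempty hE hFinf,
    fun _ hx => exists_closed_subspace_subset_weakStarNullNotNormNull hx⟩
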